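/- Let $(R,\mathfrak m,k)$ be a commutative Noetherian local ring and let $M$ be a finitely generated Cohen--Macaulay $R$-module, that is, $M=0$ or $\operatorname{depth} M=\dim M$. Let $\mu(\cdot)$ denote the minimal number of generators of a finitely generated $R$-module, let $\operatorname{type}(M)=\mu\big(\operatorname{Ext}_R^{t}(k,M)\big)$ with $t=\operatorname{depth} M$ (and $\operatorname{type}(0)=0$), and let $$e(M)=\lim_{n\to\infty}\frac{d!}{n^{d}}\,\operatorname{length}_R(M/\mathfrak m^{n}M),\qquad d=\dim M,$$ be the Hilbert--Samuel multiplicity of $M$ with respect to $\mathfrak m$ (and $e(0)=0$). Then $$e(M)\ \ge\ \max\{\mu(M),\operatorname{type}(M)\},$$ and $e(M)=\mu(M)$ if and only if $e(M)=\operatorname{type}(M)$. In particular, if $M\neq 0$, then $M$ is Ulrich (that is, a nonzero Cohen--Macaulay module with $e(M)=\mu(M)$) if and only if $e(M)=\operatorname{type}(M)$. -/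

import Mathlib

open CategoryTheory

universe u

noncomputable section

namespace CMModule

/-- The minimal number of generators `μ(M)` of a (finitely generated) module. -/
def mu (R : Type*) [CommRing R] (M : Type*) [AddCommGroup M] [Module R M] : ℕ :=
  (⊤ : Submodule R M).spanFinrank

/-- The Krull dimension of a module (the dimension of its support) as a natural number.
It is `0` for the zero module. -/
def dim (R : Type*) [CommRing R] (M : Type*) [AddCommGroup M] [Module R M] : ℕ :=
  ((Module.supportDim R M).unbotD 0).toNat

/-- The Hilbert-Samuel multiplicity `e(I, M)` of a finitely generated module `M` over a Noetherian
local ring with respect to an ideal `I` primary to the maximal ideal: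
the limit of `d! * length (M / I ^ n M) / n ^ d`, where `d = dim M`. -/
def hsMult (R : Type*) [CommRing R] (I : Ideal R) (M : Type*) [AddCommGroup M] [Module R M] : ℝ :=
  Filter.limUnder Filter.atTop fun n : ℕ =>
    ((dim R M).factorial : ℝ) *
      ((Module.length R (M ⧸ (I ^ n • (⊤ : Submodule R M)))).toNat : ℝ) / (n : ℝ) ^ dim R M

section Local

variable (R : Type*) [CommRing R] [IsLocalRing R] (M : Type*) [AddCommGroup M] [Module R M]

/-- The multiplicity `e(M)` of `M` with respect to the maximal ideal. -/
def mult : ℝ := hsMult R (IsLocalRing.maximalIdeal R) M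

/-- The depth of a finitely generated module over a Noetherian local ring: the supremum of the
lengths of the `M`-regular sequences in the maximal ideal. The condition `M ≠ (x) M` in the
definition of a regular sequence is automatic for `M ≠ 0`
(see `isWeaklyRegular_iff_isRegular`); leaving it out gives the zero module depth `∞`. -/
def depth : ℕ∞ :=
  ⨆ (rs : List R) (_ : ∀ r ∈ rs, r ∈ IsLocalRing.maximalIdeal R)
    (_ : RingTheory.Sequence.IsWeaklyRegular M rs), (rs.length : ℕ∞)

theorem isWeaklyRegular_iff_isRegular [Module.Finite R M] [Nontrivial M] (rs : List R)
    (hrs : ∀ r ∈ rs, r ∈ IsLocalRing.maximalIdeal R) :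
    RingTheory.Sequence.IsWeaklyRegular M rs ↔ RingTheory.Sequence.IsRegular M rs :=
  (IsLocalRing.isRegular_iff_isWeaklyRegular_of_subset_maximalIdeal hrs).symm

/-- `M` is Cohen-Macaulay: `M = 0`, or the depth of `M` equals its Krull dimension. -/
def IsCM : Prop :=
  Subsingleton M ∨ (depth R M : WithBot ℕ∞) = Module.supportDim R M

/-- `M` is Ulrich: a nonzero Cohen-Macaulay module with `e(M) = μ(M)`. -/
structure IsUlrich : Prop where
  nontrivial : Nontrivial M
  isCM : IsCM R M
  mult_eq : mult R M = (mu R M : ℝ)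

end Local

/-- The `n`-th Bass number of `M`: the minimal number of generators of the `R`-module
`Ext^n_R(k, M)`, where `k` is the residue field of `R`. -/
def bass (R : Type u) [CommRing R] [IsLocalRing R] (M : Type u) [AddCommGroup M] [Module R M]
    (n : ℕ) : ℕ :=
  mu R (Abelian.Ext (ModuleCat.of R (IsLocalRing.ResidueField R)) (ModuleCat.of R M) n)

/-- The type of `M`: the Bass number of `M` in degree `depth M`. -/
def type (R : Type u) [CommRing R] [IsLocalRing R] (M : Type u) [AddCommGroup M]
    [Module R M] : ℕ :=
  bass R M (depth R M).toNat

end CMModule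

end

/-!
The inequality and the equality criterion are elementary for a module `L` of finite length:
`length L ≥ length (L/𝔪L) = μ(L)` and `length L ≥ length (Soc L) = type(L)`, and each is an
equality exactly when `𝔪L = 0`. The general case is reduced to this one by cutting down with a
regular sequence `ys` of length `d = dim M` for which `e(M) = length (M/(ys)M)`.

* Reduction modulo a regular sequence in `𝔪` does not change `μ` (`mu_quotient_smul_top`), and by
  the long exact sequence of `Ext(k, -)` the module `Ext^d(k, M)` is `Hom(k, M/(ys)M)`, the socle of
  `M/(ys)M` (`bass_eq_length_socle`).
* If the residue field is infinite and `Soc M = 0`, there is an `M`-regular `y ∈ 𝔪` with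
  `(𝔪ⁿ⁺¹M : y) = 𝔪ⁿM` for large `n` (`exists_isSMulRegular_superficial`): it suffices that `y` avoids
  the associated primes of `M` and those associated primes of `⨁ 𝔪ⁿM/𝔪ⁿ⁺¹M`, over the Rees algebra,
  which do not contain the irrelevant ideal. Each of these cuts out a proper submodule of `𝔪`, and
  finitely many of those do not cover `𝔪`. For such a `y` the Hilbert function of `M/yM` is the first
  difference of that of `M`, so that `M` and `M/yM` have the same multiplicity. Induction on `d`
  gives `ys`, and shows that the limit defining `e(M)` exists
  (`exists_isWeaklyRegular_tendsto_length`).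
* To have an infinite residue field, `R` is replaced by the localization `B` of `R[X]` at `𝔪R[X]`.
  It is flat over `R` and its maximal ideal is `𝔪B`, so lengths, and with them Hilbert functions,
  `μ` and lengths of socles, are unchanged by base change. The type is compared through the socle
  of `M` modulo some regular sequence of `R`, which stays regular over `B`; the sequence `ys`
  itself exists only over `B` (`exists_finiteLength_model`).
-/

/-! ### Number of generators, socle and modules of finite length -/

namespace CMModule
open IsLocalRing TensorProduct

section
variable {R : Type*} [CommRing R]

theorem mu_congr {M N : Type*} [AddCommGroup M] [Module R M] [AddCommGroup N] [Module R N]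
    (e : M ≃ₗ[R] N) : mu R M = mu R N := by
  have h := Submodule.spanFinrank_map_eq_of_injective e.toLinearMap e.injective
    (p := (⊤ : Submodule R M))
  rw [Submodule.map_top, LinearEquiv.range] at h
  exact h.symm

theorem smul_top_quotient_smul_top_eq_bot (M : Type*) [AddCommGroup M] [Module R M] (I : Ideal R) :
    I • (⊤ : Submodule R (M ⧸ I • (⊤ : Submodule R M))) = ⊥ := by
  rw [eq_bot_iff, Submodule.smul_le]
  rintro a ha ⟨x⟩ -
  exact (Submodule.Quotient.mk_eq_zero _).2 (Submodule.smul_mem_smul ha trivial)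

variable [IsLocalRing R]

/-- Nakayama's lemma: `μ(M)` is the dimension of `M/𝔪M`, expressed as a length so that it can be
compared with other lengths. -/
theorem mu_eq_length_quotient (M : Type*) [AddCommGroup M] [Module R M] [Module.Finite R M] :
    (mu R M : ℕ∞) = Module.length R (M ⧸ maximalIdeal R • (⊤ : Submodule R M)) := by
  have h := TensorProduct.spanFinrank_top_eq_of_residueField (⊤ : Submodule R M)
    Module.Finite.fg_top
  have e1 : (⊤ : Submodule (ResidueField R) (ResidueField R ⊗[R] (⊤ : Submodule R M))).spanFinrank =
      (⊤ : Submodule (ResidueField R) (ResidueField R ⊗[R] M)).spanFinrank :=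
    mu_congr (Submodule.topEquiv.baseChange R (ResidueField R) _ _)
  rw [e1, ← Module.finrank_eq_spanFinrank_of_free] at h
  rw [mu, ← h, ← Module.length_eq_finrank,
    ← Module.length_eq_of_surjective (S := R) (residue_surjective (R := R))]
  exact (TensorProduct.quotTensorEquivQuotSMul M (maximalIdeal R)).length_eq

theorem mu_eq_length_of_smul_eq_bot (M : Type*) [AddCommGroup M] [Module R M] [Module.Finite R M]
    (h : maximalIdeal R • (⊤ : Submodule R M) = ⊥) :
    (mu R M : ℕ∞) = Module.length R M := by
  rw [mu_eq_length_quotient]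
  exact (Submodule.quotEquivOfEqBot _ h).length_eq

/-- The socle of a module over a local ring: the elements annihilated by the maximal ideal. -/
def socle (R : Type*) [CommRing R] [IsLocalRing R] (M : Type*) [AddCommGroup M] [Module R M] :
    Submodule R M :=
  Submodule.torsionBySet R M (maximalIdeal R : Set R)

theorem mem_socle {M : Type*} [AddCommGroup M] [Module R M] {x : M} :
    x ∈ socle R M ↔ ∀ a ∈ maximalIdeal R, a • x = 0 := by
  simp [socle]

theorem smul_top_eq_bot_iff_socle_eq_top {M : Type*} [AddCommGroup M] [Module R M] :
    maximalIdeal R • (⊤ : Submodule R M) = ⊥ ↔ socle R M = ⊤ := by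
  rw [eq_bot_iff, Submodule.smul_le, eq_top_iff]
  constructor
  · intro h x _
    exact mem_socle.2 fun a ha => h a ha x trivial
  · intro h a ha x _
    exact mem_socle.1 (h (x := x) trivial) a ha

/-- Evaluation at `1` identifies the maps from the residue field with the socle. -/
noncomputable def homResidueFieldEquivSocle (M : Type*) [AddCommGroup M] [Module R M] :
    (ResidueField R →ₗ[R] M) ≃ₗ[R] socle R M where
  toFun f := ⟨f 1, mem_socle.2 fun a ha => by
    rw [← map_smul, Algebra.smul_def, mul_one, ResidueField.algebraMap_eq,
      (residue_eq_zero_iff a).2 ha, map_zero]⟩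
  map_add' f g := rfl
  map_smul' r f := rfl
  invFun x := Submodule.liftQ (maximalIdeal R) (LinearMap.toSpanSingleton R M x.1)
    fun a ha => mem_socle.1 x.2 a ha
  left_inv f := by
    ext y
    obtain ⟨r, rfl⟩ := residue_surjective y
    change r • f 1 = f (residue R r)
    rw [← map_smul, Algebra.smul_def, mul_one]; rfl
  right_inv x := by
    ext
    exact one_smul R x.1

/-- `Hom(k, M)` is killed by the maximal ideal, so its number of generators is its length. -/
theorem mu_hom_residueField [IsNoetherianRing R] (M : Type*) [AddCommGroup M] [Module R M]
    [Module.Finite R M] :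
    (mu R (ResidueField R →ₗ[R] M) : ℕ∞) = Module.length R (socle R M) := by
  rw [mu_congr (homResidueFieldEquivSocle M)]
  apply mu_eq_length_of_smul_eq_bot
  rw [smul_top_eq_bot_iff_socle_eq_top, eq_top_iff]
  exact fun x _ => mem_socle.2 fun a ha => Subtype.ext (mem_socle.1 x.2 a ha)

theorem mu_le_length (M : Type*) [AddCommGroup M] [Module R M] [Module.Finite R M] :
    (mu R M : ℕ∞) ≤ Module.length R M := by
  rw [mu_eq_length_quotient]
  exact Module.length_le_of_surjective _ (Submodule.mkQ_surjective _)

theorem length_socle_le (M : Type*) [AddCommGroup M] [Module R M] :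
    Module.length R (socle R M) ≤ Module.length R M :=
  Module.length_le_of_injective _ (Submodule.subtype_injective _)

/-- For a module of finite length, both equalities say that the maximal ideal kills it. -/
theorem length_eq_mu_iff_length_eq_length_socle {M : Type*} [AddCommGroup M] [Module R M]
    (hM : IsFiniteLength R M) :
    Module.length R M = mu R M ↔ Module.length R M = Module.length R (socle R M) := by
  obtain ⟨_, _⟩ := isFiniteLength_iff_isNoetherian_isArtinian.1 hM
  rw [mu_eq_length_quotient]
  have h1 : Module.length R M = Module.length R (M ⧸ maximalIdeal R • (⊤ : Submodule R M)) ↔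
      maximalIdeal R • (⊤ : Submodule R M) = ⊥ := by
    constructor
    · intro h
      by_contra hne
      exact (Submodule.length_quotient_lt _ hne).ne' h
    · exact fun h => (Submodule.quotEquivOfEqBot _ h).length_eq.symm
  have h2 : Module.length R M = Module.length R (socle R M) ↔ socle R M = ⊤ := by
    constructor
    · intro h
      by_contra hne
      exact (Submodule.length_lt hne).ne' h
    · intro h
      rw [h, Module.length_top]
  rw [h1, h2, smul_top_eq_bot_iff_socle_eq_top]

theorem supportDim_eq_zero_of_pow_smul_top_eq_bot {M : Type*} [AddCommGroup M] [Module R M]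
    [Module.Finite R M] [Nontrivial M] {n : ℕ}
    (h : maximalIdeal R ^ n • (⊤ : Submodule R M) = ⊥) : Module.supportDim R M = 0 := by
  have hn : maximalIdeal R ^ n ≤ Module.annihilator R M := fun a ha =>
    Module.mem_annihilator.2 fun x =>
      (Submodule.mem_bot R).1 (h ▸ Submodule.smul_mem_smul ha (Submodule.mem_top (x := x)))
  have hs : Subsingleton (Module.support R M) := by
    refine ⟨fun p q => ?_⟩
    have key : ∀ p : Module.support R M, p.1.asIdeal = maximalIdeal R := fun p => by
      have hp := Module.support_eq_zeroLocus (R := R) (M := M) |>.subset p.2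
      refine ((maximalIdeal.isMaximal R).eq_of_le p.1.2.ne_top ?_).symm
      exact p.1.2.le_of_pow_le (hn.trans hp)
    exact Subtype.ext (PrimeSpectrum.ext ((key p).trans (key q).symm))
  have : Nonempty (Module.support R M) := Module.nonempty_support_of_nontrivial.to_subtype
  exact Order.krullDim_eq_zero

variable [IsNoetherianRing R]

theorem isFiniteLength_of_pow_smul_top_eq_bot {n : ℕ} (M : Type*) [AddCommGroup M] [Module R M]
    [Module.Finite R M] (h : maximalIdeal R ^ n • (⊤ : Submodule R M) = ⊥) :
    IsFiniteLength R M := by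
  induction n generalizing M with
  | zero =>
    have : Subsingleton M := by
      rw [pow_zero, Ideal.one_eq_top, Submodule.top_smul] at h
      exact Submodule.subsingleton_iff R |>.1 (subsingleton_of_bot_eq_top h.symm)
    exact Module.length_ne_top_iff.1 (by simp)
  | succ n ih =>
    set N := maximalIdeal R • (⊤ : Submodule R M) with hN
    have h1 : IsFiniteLength R N := by
      refine ih N ?_
      apply Submodule.map_injective_of_injective N.subtype_injective
      rw [Submodule.map_smul'', Submodule.map_top, Submodule.range_subtype, Submodule.map_bot,
        hN, ← Submodule.mul_smul, ← pow_succ, h]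
    rw [← Module.length_ne_top_iff] at h1 ⊢
    rw [Module.length_eq_add_of_exact N.subtype N.mkQ N.subtype_injective N.mkQ_surjective
      (LinearMap.exact_subtype_mkQ N), ← mu_eq_length_quotient]
    simp [h1]

theorem isFiniteLength_quotient_pow_smul (M : Type*) [AddCommGroup M] [Module R M]
    [Module.Finite R M] (n : ℕ) :
    IsFiniteLength R (M ⧸ maximalIdeal R ^ n • (⊤ : Submodule R M)) :=
  isFiniteLength_of_pow_smul_top_eq_bot _ (smul_top_quotient_smul_top_eq_bot M _)

theorem exists_pow_smul_top_eq_bot_of_supportDim_eq_zero (M : Type*) [AddCommGroup M] [Module R M]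
    [Module.Finite R M] (h : Module.supportDim R M = 0) :
    ∃ n, maximalIdeal R ^ n • (⊤ : Submodule R M) = ⊥ := by
  have hs := support_of_supportDim_eq_zero R M h
  rw [Module.support_eq_zeroLocus] at hs
  have hr : (Module.annihilator R M).radical = maximalIdeal R := by
    rw [← PrimeSpectrum.vanishingIdeal_zeroLocus_eq_radical, hs,
      PrimeSpectrum.vanishingIdeal_zeroLocus_eq_radical, (maximalIdeal.isMaximal R).isPrime.radical]
  obtain ⟨n, hn⟩ := Ideal.exists_radical_pow_le_of_fg (Module.annihilator R M)
    (IsNoetherian.noetherian _)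
  rw [hr] at hn
  refine ⟨n, eq_bot_iff.2 (Submodule.smul_le.2 fun a ha x _ => ?_)⟩
  exact Module.mem_annihilator.1 (hn ha) x

end
end CMModule

/-! ### `Ext` and regular sequences -/

namespace CMModule
open IsLocalRing TensorProduct Abelian

section
variable {R : Type u} [CommRing R]

/-- If multiplication by `r` is injective on `M`, kills `X`, and `Ext^n(X, M) = 0`, then the
connecting map `Ext^n(X, M/rM) → Ext^{n+1}(X, M)` is an isomorphism. -/
theorem nonempty_ext_quotSMulTop_equiv {X M : Type u} [AddCommGroup X] [Module R X]
    [AddCommGroup M] [Module R M] {r : R} (hr : IsSMulRegular M r)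
    (hX : r ∈ Module.annihilator R X) (n : ℕ)
    (h0 : Subsingleton (Ext (ModuleCat.of R X) (ModuleCat.of R M) n)) :
    Nonempty (Ext (ModuleCat.of R X) (ModuleCat.of R (QuotSMulTop r M)) n ≃ₗ[R]
      Ext (ModuleCat.of R X) (ModuleCat.of R M) (n + 1)) := by
  have hS : (ModuleCat.smulShortComplex (ModuleCat.of R M) r).ShortExact :=
    IsSMulRegular.smulShortComplex_shortExact hr
  -- `r` kills `X`, so multiplication by `r` on `M` induces zero on `Ext(X, M)`
  have hz : ∀ (n : ℕ) (x : Ext (ModuleCat.of R X) (ModuleCat.of R M) n),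
      x.comp (Ext.mk₀ (ModuleCat.smulShortComplex (ModuleCat.of R M) r).f) (add_zero n) = 0 := by
    intro n x
    have := Ext.postcomp_smul_id_eq_zero_of_mem_annihilator (M := ModuleCat.of R M)
      (N := ModuleCat.of R X) hX n
    exact congr($(this) x)
  let δ := (Ext.bilinearCompOfLinear R (ModuleCat.of R X)
    (ModuleCat.of R (QuotSMulTop r M)) (ModuleCat.of R M) n 1 (n + 1) rfl).flip hS.extClass
  refine ⟨LinearEquiv.ofBijective δ ⟨?_, fun x => ?_⟩⟩
  · rw [injective_iff_map_eq_zero]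
    intro x hx
    obtain ⟨y, hy⟩ := Ext.covariant_sequence_exact₃ (ModuleCat.of R X) hS x rfl hx
    have hy0 : y = 0 := h0.elim y _
    rw [← hy, hy0, Ext.zero_comp]
    rfl
  · exact Ext.covariant_sequence_exact₁ (ModuleCat.of R X) hS x (hz _ x) rfl

/-- The vanishing of `Ext^n` and `Ext^{n+1}` passes to `Ext^n` of the quotient by a regular
element. -/
theorem subsingleton_ext_quotSMulTop {X M : Type u} [AddCommGroup X] [Module R X]
    [AddCommGroup M] [Module R M] {r : R} (hr : IsSMulRegular M r)
    (hX : r ∈ Module.annihilator R X) (n : ℕ)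
    (h0 : Subsingleton (Ext (ModuleCat.of R X) (ModuleCat.of R M) n))
    (h1 : Subsingleton (Ext (ModuleCat.of R X) (ModuleCat.of R M) (n + 1))) :
    Subsingleton (Ext (ModuleCat.of R X) (ModuleCat.of R (QuotSMulTop r M)) n) := by
  obtain ⟨e⟩ := nonempty_ext_quotSMulTop_equiv hr hX n h0
  exact e.toEquiv.subsingleton

theorem subsingleton_ext_zero_of_isSMulRegular {X M : Type u} [AddCommGroup X] [Module R X]
    [AddCommGroup M] [Module R M] {r : R} (hr : IsSMulRegular M r)
    (hX : r ∈ Module.annihilator R X) :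
    Subsingleton (Ext (ModuleCat.of R X) (ModuleCat.of R M) 0) := by
  have e := (Ext.linearEquiv₀ (R := R) (X := ModuleCat.of R X) (Y := ModuleCat.of R M)).trans
    (ModuleCat.homLinearEquiv (S := R))
  refine e.toEquiv.subsingleton_congr.2 ⟨fun f g => LinearMap.ext fun x => hr ?_⟩
  change r • f x = r • g x
  rw [← map_smul, ← map_smul, Module.mem_annihilator.1 hX, map_zero, map_zero]

/-- The depth bound of Rees: if a regular sequence `rs` on `M` kills `X`, then `Ext^i(X, M) = 0` for
`i < |rs|`. -/
theorem subsingleton_ext_of_isWeaklyRegular {X : Type u} [AddCommGroup X] [Module R X]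
    (rs : List R) (M : Type u) [AddCommGroup M] [Module R M]
    (hX : ∀ r ∈ rs, r ∈ Module.annihilator R X)
    (h : RingTheory.Sequence.IsWeaklyRegular M rs) (i : ℕ) (hi : i < rs.length) :
    Subsingleton (Ext (ModuleCat.of R X) (ModuleCat.of R M) i) := by
  induction rs generalizing M i with
  | nil => simp at hi
  | cons r rs ih =>
    rw [RingTheory.Sequence.isWeaklyRegular_cons_iff] at h
    have hr := hX r List.mem_cons_self
    induction i with
    | zero => exact subsingleton_ext_zero_of_isSMulRegular h.1 hr
    | succ i ihi =>
      rw [List.length_cons] at hi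
      obtain ⟨e⟩ := nonempty_ext_quotSMulTop_equiv h.1 hr i (ihi (by simp; omega))
      have := ih (QuotSMulTop r M) (fun r hr => hX r (List.mem_cons_of_mem _ hr)) h.2 i (by omega)
      exact e.symm.toEquiv.subsingleton

/-- Iterating the connecting isomorphisms: if a regular sequence `rs` on `M` kills `X`, then
`Ext^{|rs|}(X, M)` is `Hom(X, M/(rs)M)`. -/
theorem nonempty_ext_equiv_of_isWeaklyRegular {X : Type u} [AddCommGroup X] [Module R X]
    (rs : List R) (M : Type u) [AddCommGroup M] [Module R M]
    (hX : ∀ r ∈ rs, r ∈ Module.annihilator R X)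
    (h : RingTheory.Sequence.IsWeaklyRegular M rs) :
    Nonempty (Ext (ModuleCat.of R X) (ModuleCat.of R M) rs.length ≃ₗ[R]
      (X →ₗ[R] M ⧸ Ideal.ofList rs • (⊤ : Submodule R M))) := by
  induction rs generalizing M with
  | nil =>
    have e := (Ext.linearEquiv₀ (R := R) (X := ModuleCat.of R X) (Y := ModuleCat.of R M)).trans
      (ModuleCat.homLinearEquiv (S := R))
    exact ⟨e.trans (LinearEquiv.congrRight (Submodule.quotEquivOfEqBot _ (by simp)).symm)⟩
  | cons r rs ih =>
    have h' := (RingTheory.Sequence.isWeaklyRegular_cons_iff _ _ _).1 h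
    obtain ⟨e1⟩ := nonempty_ext_quotSMulTop_equiv h'.1 (hX r List.mem_cons_self) rs.length
      (subsingleton_ext_of_isWeaklyRegular _ M hX h _ (by simp))
    obtain ⟨e2⟩ := ih (QuotSMulTop r M) (fun r hr => hX r (List.mem_cons_of_mem _ hr)) h'.2
    exact ⟨e1.symm.trans (e2.trans (LinearEquiv.congrRight
      (Submodule.quotOfListConsSMulTopEquivQuotSMulTopInner M r rs).symm))⟩

variable [IsLocalRing R]

theorem mem_annihilator_residueField {r : R} (hr : r ∈ maximalIdeal R) :
    r ∈ Module.annihilator R (ResidueField R) := by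
  refine Module.mem_annihilator.2 fun x => ?_
  rw [Algebra.smul_def, ResidueField.algebraMap_eq, (residue_eq_zero_iff r).2 hr, zero_mul]

/-- Rees' description of a Bass number by a regular sequence: in degree `|rs|` it is the length
of the socle of `M/(rs)M`. -/
theorem bass_eq_length_socle [IsNoetherianRing R] {rs : List R} (hrs : ∀ r ∈ rs, r ∈ maximalIdeal R)
    (M : Type u) [AddCommGroup M] [Module R M] [Module.Finite R M]
    (h : RingTheory.Sequence.IsWeaklyRegular M rs) :
    (bass R M rs.length : ℕ∞) =
      Module.length R (socle R (M ⧸ Ideal.ofList rs • (⊤ : Submodule R M))) := by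
  obtain ⟨e⟩ := nonempty_ext_equiv_of_isWeaklyRegular (X := ResidueField R) rs M
    (fun r hr => mem_annihilator_residueField (hrs r hr)) h
  rw [bass, mu_congr e, mu_hom_residueField]

end

section
variable {R : Type*} [CommRing R] [IsLocalRing R]

theorem mu_quotient_smul_top (M : Type*) [AddCommGroup M] [Module R M] [Module.Finite R M]
    {I : Ideal R} (hI : I ≤ maximalIdeal R) :
    mu R (M ⧸ I • (⊤ : Submodule R M)) = mu R M := by
  have h : (mu R (M ⧸ I • (⊤ : Submodule R M)) : ℕ∞) = mu R M := by
    rw [mu_eq_length_quotient, mu_eq_length_quotient]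
    have : maximalIdeal R • (⊤ : Submodule R (M ⧸ I • (⊤ : Submodule R M))) =
        (maximalIdeal R • (⊤ : Submodule R M)).map (I • (⊤ : Submodule R M)).mkQ := by
      rw [Submodule.map_smul'', Submodule.map_top, Submodule.range_mkQ]
    rw [this]
    exact (Submodule.quotientQuotientEquivQuotient _ _ (Submodule.smul_mono_left hI)).length_eq
  exact_mod_cast h
end
end CMModule

/-! ### Superficial elements -/

namespace CMModule
open IsLocalRing Polynomial

section Avoidance
variable {R : Type*} [CommRing R] [IsLocalRing R] [Infinite (ResidueField R)]

/-- The cyclic submodule generated by a nonzero element surjects onto the residue field. -/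
theorem infinite_of_infinite_residueField (N : Type*) [AddCommGroup N] [Module R N]
    [Nontrivial N] : Infinite N := by
  obtain ⟨x, hx⟩ := exists_ne (0 : N)
  refine Infinite.of_injective
    (fun q : ResidueField R => Function.surjInv residue_surjective q • x) fun p q hpq => ?_
  rw [← Function.surjInv_eq residue_surjective p, ← Function.surjInv_eq residue_surjective q,
    ← sub_eq_zero, ← map_sub, residue_eq_zero_iff]
  by_contra hu
  rw [mem_maximalIdeal, mem_nonunits_iff, not_not] at hu
  refine hx ((hu.smul_eq_zero).1 ?_)
  rw [sub_smul, sub_eq_zero]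
  exact hpq

/-- Over an infinite residue field, finitely many proper submodules do not cover a module: one of
them would have finite index (B. H. Neumann). -/
theorem exists_forall_notMem_of_finite {E : Type*} [AddCommGroup E] [Module R E]
    {s : Set (Submodule R E)} (hs : s.Finite) (hne : ∀ V ∈ s, V ≠ ⊤) : ∃ x, ∀ V ∈ s, x ∉ V := by
  by_contra! h
  obtain ⟨V, hV, hfi⟩ := Submodule.exists_finiteIndex_of_cover (s := hs.toFinset) (p := id) (by
    rw [Set.eq_univ_iff_forall]
    intro x
    obtain ⟨V, hV, hx⟩ := h x
    exact Set.mem_biUnion (hs.mem_toFinset.2 hV) hx)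
  have hfi' : V.toAddSubgroup.FiniteIndex := hfi
  have : Finite (E ⧸ V) := AddSubgroup.finite_quotient_of_finiteIndex
  have : Nontrivial (E ⧸ V) := Submodule.Quotient.nontrivial_iff.mpr (hne V (hs.mem_toFinset.1 hV))
  have := infinite_of_infinite_residueField (R := R) (E ⧸ V)
  exact not_finite (E ⧸ V)

end Avoidance

/-- The quotient of a submodule `A` by its intersection with a submodule `B`. -/
abbrev Subquotient {S P : Type*} [CommRing S] [AddCommGroup P] [Module S P]
    (A B : Submodule S P) : Type _ :=
  A ⧸ B.submoduleOf A

section Rees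
variable {R : Type*} [CommRing R] (I : Ideal R) (M : Type*) [AddCommGroup M] [Module R M]

/-- The degree one part `I t` of the Rees algebra of `I`. -/
noncomputable def reesDegreeOne : I →ₗ[R] reesAlgebra I where
  toFun a := ⟨monomial 1 a.1, reesAlgebra.monomial_mem.2 (by simp)⟩
  map_add' a b := Subtype.ext (by simp)
  map_smul' r a := Subtype.ext (by simp [smul_monomial])

/-- The Rees module `⨁ Iⁿ M`. -/
noncomputable abbrev reesModule : Submodule (reesAlgebra I) (PolynomialModule R M) :=
  (I.stableFiltration (⊤ : Submodule R M)).submodule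

/-- The submodule `⨁ Iⁿ⁺¹ M` of the Rees module. -/
noncomputable abbrev reesModuleSucc : Submodule (reesAlgebra I) (PolynomialModule R M) :=
  (I.stableFiltration (I • (⊤ : Submodule R M))).submodule

/-- The associated graded module `⨁ Iⁿ M / Iⁿ⁺¹ M`, as a module over the Rees algebra. -/
abbrev grModule : Type _ :=
  Subquotient (reesModule I M) (reesModuleSucc I M)

variable {I M}

theorem mem_reesModule {f : PolynomialModule R M} :
    f ∈ reesModule I M ↔ ∀ i, f.coeff i ∈ I ^ i • (⊤ : Submodule R M) := Iff.rfl

theorem mem_reesModuleSucc {f : PolynomialModule R M} :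
    f ∈ reesModuleSucc I M ↔ ∀ i, f.coeff i ∈ I ^ (i + 1) • (⊤ : Submodule R M) := by
  rw [Ideal.Filtration.mem_submodule]
  simp [Ideal.stableFiltration_N, ← Submodule.mul_smul, ← pow_succ]

instance [IsNoetherianRing R] [Module.Finite R M] :
    IsNoetherian (reesAlgebra I) (reesModule I M) := by
  apply isNoetherian_of_fg_of_noetherian
  rw [Ideal.Filtration.submodule_fg_iff_stable _ fun i => IsNoetherian.noetherian _]
  exact Ideal.stableFiltration_stable I ⊤

/-- The forms of degree at least `N` in the Rees algebra lie in the `N`-th power of the ideal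
generated by the forms of degree one. -/
theorem exists_mem_span_pow_eq_monomial (N : ℕ) {a : ℕ} (ha : N ≤ a) {r : R} (hr : r ∈ I ^ a) :
    ∃ s ∈ (Ideal.span (Set.range (reesDegreeOne I))) ^ N, (s : R[X]) = monomial a r := by
  induction N generalizing a r with
  | zero => exact ⟨⟨monomial a r, reesAlgebra.monomial_mem.2 hr⟩, by simp, rfl⟩
  | succ N ih =>
    obtain ⟨a, rfl⟩ : ∃ b, a = b + 1 := ⟨a - 1, by omega⟩
    rw [pow_succ'] at hr
    refine Submodule.mul_induction_on hr (fun x hx r' hr' => ?_) fun x y hx hy => ?_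
    · obtain ⟨s, hs, hsr⟩ := ih (by omega) hr'
      refine ⟨reesDegreeOne I ⟨x, hx⟩ * s, ?_, ?_⟩
      · rw [pow_succ']
        exact Ideal.mul_mem_mul (Ideal.subset_span ⟨_, rfl⟩) hs
      · rw [MulMemClass.coe_mul, hsr, reesDegreeOne, LinearMap.coe_mk, AddHom.coe_mk,
          monomial_mul_monomial, add_comm]
    · obtain ⟨s, hs, hsr⟩ := hx
      obtain ⟨t, ht, htr⟩ := hy
      exact ⟨s + t, add_mem hs ht, by rw [AddMemClass.coe_add, hsr, htr, map_add]⟩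

/-- A submodule of the associated graded module killed by a power of the irrelevant ideal vanishes
in all large degrees. -/
theorem exists_coeff_mem_of_pow_span_le_annihilator [IsNoetherianRing R] [Module.Finite R M]
    (K : Submodule (reesAlgebra I) (grModule I M)) (N : ℕ)
    (hN : (Ideal.span (Set.range (reesDegreeOne I))) ^ N ≤ Module.annihilator _ K) :
    ∃ c, ∀ f : reesModule I M, Submodule.Quotient.mk f ∈ K → ∀ n ≥ c,
      f.1.coeff n ∈ I ^ (n + 1) • (⊤ : Submodule R M) := by
  classical
  obtain ⟨T, hT⟩ := (IsNoetherian.noetherian K : K.FG)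
  -- a bound for the degrees of lifts of the generators of `K`
  let D : ℕ := T.sup fun g => (Quotient.out g : reesModule I M).1.coeff.support.sup id
  -- the claim about a coefficient only depends on the class of a lift
  have hind : ∀ (f g : reesModule I M),
      (Submodule.Quotient.mk f : grModule I M) = Submodule.Quotient.mk g → ∀ n,
      g.1.coeff n ∈ I ^ (n + 1) • (⊤ : Submodule R M) →
      f.1.coeff n ∈ I ^ (n + 1) • (⊤ : Submodule R M) := by
    intro f g hfg n hg
    rw [Submodule.Quotient.eq] at hfg
    have h1 := mem_reesModuleSucc.1 (Submodule.mem_comap.1 hfg) n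
    have h2 := add_mem h1 hg
    rw [← Finsupp.add_apply, ← PolynomialModule.coeff_add] at h2
    rwa [show f.1 = (reesModule I M).subtype (f - g) + g.1 by simp]
  refine ⟨D + N, fun f hf n hn => ?_⟩
  suffices h : ∃ g : reesModule I M, (Submodule.Quotient.mk g : grModule I M) =
      Submodule.Quotient.mk f ∧ g.1.coeff n ∈ I ^ (n + 1) • (⊤ : Submodule R M) by
    obtain ⟨g, hg, hgn⟩ := h
    exact hind f g hg.symm n hgn
  rw [← hT] at hf
  generalize (Submodule.Quotient.mk f : grModule I M) = x at hf ⊢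
  induction hf using Submodule.closure_induction with
  | zero => exact ⟨0, rfl, by simp⟩
  | add x y hx hy ihx ihy =>
    obtain ⟨g, hg, hgn⟩ := ihx
    obtain ⟨g', hg', hgn'⟩ := ihy
    exact ⟨g + g', by rw [Submodule.Quotient.mk_add, hg, hg'], by simpa using add_mem hgn hgn'⟩
  | smul_mem r x hx =>
    set g : reesModule I M := Quotient.out x with hg
    have hgx : (Submodule.Quotient.mk g : grModule I M) = x := Quotient.out_eq x
    refine ⟨r • g, by rw [Submodule.Quotient.mk_smul, hgx], ?_⟩
    change (r.1 • g.1).coeff n ∈ _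
    rw [PolynomialModule.smul_apply]
    refine Submodule.sum_mem _ fun ab hab => ?_
    obtain ⟨a, b⟩ := ab
    rw [Finset.HasAntidiagonal.mem_antidiagonal] at hab
    dsimp only at hab ⊢
    by_cases hb : g.1.coeff b = 0
    · rw [hb, smul_zero]; exact zero_mem _
    have hbD : b ≤ D := (Finset.le_sup (f := id) (Finsupp.mem_support_iff.2 hb)).trans
      (Finset.le_sup (f := fun g : grModule I M =>
        (Quotient.out g : reesModule I M).1.coeff.support.sup id) hx)
    obtain ⟨s, hs, hsr⟩ := exists_mem_span_pow_eq_monomial N (a := a) (by omega) (r.2 a)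
    have hK : x ∈ K := hT ▸ Submodule.subset_span hx
    have h0 : s • x = 0 := congr_arg Subtype.val (Module.mem_annihilator.1 (hN hs) ⟨x, hK⟩)
    rw [← hgx, ← Submodule.Quotient.mk_smul, Submodule.Quotient.mk_eq_zero,
      Submodule.submoduleOf, Submodule.mem_comap,
      Submodule.subtype_apply, mem_reesModuleSucc] at h0
    have h1 := h0 n
    change (s.1 • g.1).coeff n ∈ _ at h1
    rw [hsr, PolynomialModule.monomial_smul_apply, if_pos (by omega)] at h1
    rwa [show n - a = b by omega] at h1

/-- If an element `y` of `I` lies, as a form of degree one, in no associated prime of the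
associated graded module other than those containing all forms of degree one, then multiplication
by `y` is injective on the associated graded module in large degrees. -/
theorem exists_smul_mem_imp_mem [IsNoetherianRing R] [Module.Finite R M] (y : I)
    (hy : ∀ Q ∈ associatedPrimes (reesAlgebra I) (grModule I M),
      reesDegreeOne I y ∈ Q → ∀ a, reesDegreeOne I a ∈ Q) :
    ∃ c, ∀ n ≥ c, ∀ z ∈ I ^ n • (⊤ : Submodule R M),
      y.1 • z ∈ I ^ (n + 2) • (⊤ : Submodule R M) → z ∈ I ^ (n + 1) • (⊤ : Submodule R M) := by
  set K : Submodule (reesAlgebra I) (grModule I M) :=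
    LinearMap.ker (LinearMap.lsmul (reesAlgebra I) (grModule I M) (reesDegreeOne I y)) with hK
  have hyK : reesDegreeOne I y ∈ Module.annihilator (reesAlgebra I) K :=
    Module.mem_annihilator.2 fun x => Subtype.ext x.2
  -- the associated primes of `K` are associated primes of the graded module containing `y`
  have hJ : Ideal.span (Set.range (reesDegreeOne I)) ≤
      (Module.annihilator (reesAlgebra I) K).radical := by
    rw [← Ideal.sInf_minimalPrimes, le_sInf_iff]
    intro Q hQ
    have hQK := Module.associatedPrimes.minimalPrimes_annihilator_subset_associatedPrimes _ _ hQ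
    have hQG := associatedPrimes.subset_of_injective K.subtype_injective hQK
    rw [Ideal.span_le]
    rintro _ ⟨a, rfl⟩
    exact hy Q hQG (hQ.1.2 hyK) a
  obtain ⟨N, hN⟩ := Ideal.exists_pow_le_of_le_radical_of_fg hJ (IsNoetherian.noetherian _)
  obtain ⟨c, hc⟩ := exists_coeff_mem_of_pow_span_le_annihilator K N hN
  refine ⟨c, fun n hn z hz hyz => ?_⟩
  have hsz : PolynomialModule.single R n z ∈ reesModule I M := by
    rw [mem_reesModule]
    intro i
    rw [PolynomialModule.coeff_single, Finsupp.single_apply]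
    split_ifs with h
    · exact h ▸ hz
    · exact zero_mem _
  have := hc ⟨_, hsz⟩ ?_ n hn
  · simpa using this
  · rw [hK, LinearMap.mem_ker, LinearMap.lsmul_apply, ← Submodule.Quotient.mk_smul,
      Submodule.Quotient.mk_eq_zero, Submodule.submoduleOf, Submodule.mem_comap,
      Submodule.subtype_apply, mem_reesModuleSucc]
    intro i
    change ((monomial 1 y.1 : R[X]) • PolynomialModule.single R n z).coeff i ∈ _
    rw [PolynomialModule.monomial_smul_single, PolynomialModule.coeff_single, Finsupp.single_apply]
    split_ifs with h
    · rw [← h, add_comm 1 n]; exact hyz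
    · exact zero_mem _

/-- By the Artin-Rees lemma, injectivity on the associated graded module in large degrees becomes
`(Iⁿ⁺¹M : y) = IⁿM` for large `n` when `y` is `M`-regular. -/
theorem exists_forall_smul_mem_pow_imp [IsNoetherianRing R] [Module.Finite R M] {y : R}
    (hreg : IsSMulRegular M y) {c : ℕ}
    (hc : ∀ n ≥ c, ∀ z ∈ I ^ n • (⊤ : Submodule R M),
      y • z ∈ I ^ (n + 2) • (⊤ : Submodule R M) → z ∈ I ^ (n + 1) • (⊤ : Submodule R M)) :
    ∃ n₀, ∀ n ≥ n₀, ∀ z : M, y • z ∈ I ^ (n + 1) • (⊤ : Submodule R M) →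
      z ∈ I ^ n • (⊤ : Submodule R M) := by
  obtain ⟨k, hk⟩ := I.exists_pow_inf_eq_pow_smul (LinearMap.range (LinearMap.lsmul R M y))
  refine ⟨c + k, fun n hn z hz => ?_⟩
  have h1 : z ∈ I ^ c • (⊤ : Submodule R M) := by
    have h2 : y • z ∈ I ^ (n + 1 - k) • LinearMap.range (LinearMap.lsmul R M y) := by
      refine Submodule.smul_mono le_rfl inf_le_right ((hk (n + 1) (by omega)).le ⟨hz, z, rfl⟩)
    rw [← Submodule.map_top, ← Submodule.map_smul''] at h2
    obtain ⟨w, hw, hwz⟩ := h2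
    rw [← hreg hwz]
    exact Submodule.smul_mono_left (Ideal.pow_le_pow_right (by omega)) hw
  have h3 : ∀ j, c + j ≤ n → z ∈ I ^ (c + j) • (⊤ : Submodule R M) := by
    intro j
    induction j with
    | zero => exact fun _ => h1
    | succ j ih =>
      intro hj
      exact hc (c + j) (by omega) z (ih (by omega))
        (Submodule.smul_mono_left (Ideal.pow_le_pow_right (by omega)) hz)
  have := h3 (n - c) (by omega)
  rwa [show c + (n - c) = n by omega] at this

end Rees

/-- Existence of a regular superficial element over an infinite residue field. -/
theorem exists_isSMulRegular_superficial {R : Type*} [CommRing R] [IsLocalRing R]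
    [IsNoetherianRing R] [Infinite (ResidueField R)] (M : Type*) [AddCommGroup M] [Module R M]
    [Module.Finite R M] (hM : socle R M = ⊥) :
    ∃ y ∈ maximalIdeal R, IsSMulRegular M y ∧ ∃ n₀, ∀ n ≥ n₀, ∀ z : M,
      y • z ∈ maximalIdeal R ^ (n + 1) • (⊤ : Submodule R M) →
        z ∈ maximalIdeal R ^ n • (⊤ : Submodule R M) := by
  set m := maximalIdeal R with hm
  -- the traces on `m` of associated primes of `M` and of the associated graded module
  let V₁ : Ideal R → Submodule R m := fun p => Submodule.comap m.subtype p
  let V₂ : Ideal (reesAlgebra m) → Submodule R m := fun Q =>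
    Submodule.comap (reesDegreeOne m) (Q.restrictScalars R)
  obtain ⟨y, hy⟩ := exists_forall_notMem_of_finite
    (s := (V₁ '' associatedPrimes R M ∪
      V₂ '' associatedPrimes (reesAlgebra m) (grModule m M)) \ {⊤})
    ((((associatedPrimes.finite R M).image _).union
      ((associatedPrimes.finite _ _).image _)).sdiff) (fun V hV => hV.2)
  have hreg : IsSMulRegular M y.1 := by
    by_contra h
    have h' : y.1 ∈ ⋃ p ∈ associatedPrimes R M, (p : Set R) := by
      rw [biUnion_associatedPrimes_eq_compl_regular]
      exact h
    simp only [Set.mem_iUnion, SetLike.mem_coe] at h'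
    obtain ⟨p, hp, hyp⟩ := h'
    by_cases htop : V₁ p = ⊤
    -- a prime containing `m` would be the annihilator of a nonzero element of the socle
    · obtain ⟨hpp, x, hx⟩ := isAssociatedPrime_iff.1 hp
      have hxs : x ∈ socle R M := mem_socle.2 fun a ha => by
        have h1 : (⟨a, ha⟩ : m) ∈ V₁ p := htop ▸ trivial
        have h2 : a ∈ p := h1
        rwa [hx, Submodule.mem_colon_singleton, Submodule.mem_bot] at h2
      rw [hM, Submodule.mem_bot] at hxs
      refine hpp.ne_top ?_
      rw [hx, hxs]
      ext; simp
    · exact hy (V₁ p) ⟨Or.inl ⟨p, hp, rfl⟩, htop⟩ hyp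
  obtain ⟨c, hc⟩ := exists_smul_mem_imp_mem (M := M) y fun Q hQ hyQ a => by
    by_cases htop : V₂ Q = ⊤
    · have h1 : a ∈ V₂ Q := htop ▸ trivial
      exact h1
    · exact absurd hyQ (hy (V₂ Q) ⟨Or.inr ⟨Q, hQ, rfl⟩, htop⟩)
  exact ⟨y, y.2, hreg, exists_forall_smul_mem_pow_imp hreg hc⟩

end CMModule

/-! ### Hilbert functions and multiplicity -/

namespace CMModule
open IsLocalRing Filter Topology

/-- A Stolz-Cesàro argument: a sequence whose differences grow like `e n^d / d!` grows like `e n^(d+1) / (d+1)!`. -/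
theorem tendsto_factorial_mul_div_pow_succ {H D : ℕ → ℝ} {d : ℕ} {e : ℝ}
    (hD : Tendsto (fun n : ℕ => (d.factorial : ℝ) * D n / (n : ℝ) ^ d) atTop (𝓝 e))
    (hH : ∀ᶠ n in atTop, H (n + 1) - H n = D (n + 1)) :
    Tendsto (fun n : ℕ => ((d + 1).factorial : ℝ) * H n / (n : ℝ) ^ (d + 1)) atTop (𝓝 e) := by
  set g : ℕ → ℝ := fun n => ((n + 1 : ℕ) : ℝ) ^ (d + 1) - (n : ℝ) ^ (d + 1) with hg
  have hg0 : ∀ n, 0 < g n := fun n => sub_pos.2 (by gcongr; simp)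
  have hsum : ∀ n, ∑ i ∈ Finset.range n, g i = (n : ℝ) ^ (d + 1) := fun n => by
    rw [hg, Finset.sum_range_sub (fun i : ℕ => (i : ℝ) ^ (d + 1))]
    simp
  have hpow : Tendsto (fun n : ℕ => (n : ℝ) ^ (d + 1)) atTop atTop :=
    (tendsto_pow_atTop (by simp)).comp tendsto_natCast_atTop_atTop
  -- `g n / (n + 1) ^ d` is the geometric sum of `n / (n + 1)`
  have hgd : Tendsto (fun n : ℕ => g n / ((n + 1 : ℕ) : ℝ) ^ d) atTop (𝓝 ((d + 1 : ℕ) : ℝ)) := by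
    have hx : Tendsto (fun n : ℕ => (n : ℝ) / ((n : ℝ) + 1)) atTop (𝓝 1) :=
      tendsto_natCast_div_add_atTop 1
    have hs : Tendsto (fun n : ℕ => ∑ i ∈ Finset.range (d + 1), ((n : ℝ) / ((n : ℝ) + 1)) ^ i)
        atTop (𝓝 (∑ i ∈ Finset.range (d + 1), (1 : ℝ) ^ i)) :=
      tendsto_finsetSum _ fun i _ => hx.pow i
    simp only [one_pow, Finset.sum_const, Finset.card_range, nsmul_eq_mul, mul_one] at hs
    refine hs.congr fun n => ?_
    have hn : (n : ℝ) + 1 ≠ 0 := by positivity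
    have hgeom := geom_sum_mul ((n : ℝ) / ((n : ℝ) + 1)) (d + 1)
    have h1 : (n : ℝ) / ((n : ℝ) + 1) - 1 = -1 / ((n : ℝ) + 1) := by field_simp; ring
    rw [h1, div_pow] at hgeom
    rw [hg]
    push_cast
    field_simp at hgeom ⊢
    rw [pow_succ ((n : ℝ) + 1) d] at hgeom ⊢
    have hp : ((n : ℝ) + 1) ^ d ≠ 0 := by positivity
    refine mul_left_cancel₀ hn ?_
    linarith
  have hD' : Tendsto (fun n : ℕ => D (n + 1) / g n) atTop (𝓝 (e / (d + 1).factorial)) := by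
    have h1 := ((tendsto_add_atTop_iff_nat 1).2 hD).div hgd (by positivity)
    have h2 := h1.div_const (d.factorial : ℝ)
    have h3 : e / ((d + 1 : ℕ) : ℝ) / (d.factorial : ℝ) = e / (d + 1).factorial := by
      rw [Nat.factorial_succ, Nat.cast_mul, div_div]
    rw [h3] at h2
    refine h2.congr fun n => ?_
    have := (hg0 n).ne'
    have hp : ((n + 1 : ℕ) : ℝ) ^ d ≠ 0 := by positivity
    have hf : (d.factorial : ℝ) ≠ 0 := by positivity
    simp only [Pi.div_apply]
    field_simp
  have ho : (fun n => (H (n + 1) - H n) - e / (d + 1).factorial * g n) =o[atTop] g := by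
    rw [Asymptotics.isLittleO_iff_tendsto' (Eventually.of_forall fun n h => absurd h (hg0 n).ne')]
    have h1 := hD'.sub_const (e / (d + 1).factorial)
    rw [sub_self] at h1
    refine h1.congr' ?_
    filter_upwards [hH] with n hn
    rw [hn]
    have := (hg0 n).ne'
    field_simp
  have hS := ho.sum_range (fun n => (hg0 n).le) (by simpa only [hsum] using hpow)
  have hsum' : ∀ n, ∑ i ∈ Finset.range n, ((H (i + 1) - H i) - e / (d + 1).factorial * g i) =
      H n - H 0 - e / (d + 1).factorial * (n : ℝ) ^ (d + 1) := fun n => by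
    rw [Finset.sum_sub_distrib, ← Finset.mul_sum, hsum, Finset.sum_range_sub]
  simp only [hsum, hsum'] at hS
  have h0 : ∀ᶠ n : ℕ in atTop, (n : ℝ) ^ (d + 1) ≠ 0 := by
    filter_upwards [eventually_gt_atTop 0] with n hn
    positivity
  rw [Asymptotics.isLittleO_iff_tendsto' (h0.mono fun n hn h => absurd h hn)] at hS
  have hlim := ((hS.add ((tendsto_const_nhds (x := H 0)).div_atTop hpow)).add_const
    (e / (d + 1).factorial)).const_mul ((d + 1).factorial : ℝ)
  have hf : ((d + 1).factorial : ℝ) ≠ 0 := by positivity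
  rw [zero_add, zero_add, mul_div_cancel₀ _ hf] at hlim
  refine hlim.congr' ?_
  filter_upwards [h0] with n hn
  field_simp
  ring

section
open scoped Pointwise
variable {R : Type*} [CommRing R]

/-- The exact sequence `0 → M/IⁿM → M/Iⁿ⁺¹M → M̄/Iⁿ⁺¹M̄ → 0` for `M̄ = M/yM`, whose first map is
multiplication by `y`. -/
theorem length_quotient_pow_succ_smul (I : Ideal R) {M : Type*} [AddCommGroup M] [Module R M]
    {y : R} (hy : y ∈ I) {n : ℕ}
    (h : ∀ z : M, y • z ∈ I ^ (n + 1) • (⊤ : Submodule R M) → z ∈ I ^ n • (⊤ : Submodule R M)) :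
    Module.length R (M ⧸ I ^ (n + 1) • (⊤ : Submodule R M)) =
      Module.length R (M ⧸ I ^ n • (⊤ : Submodule R M)) +
      Module.length R (QuotSMulTop y M ⧸ I ^ (n + 1) • (⊤ : Submodule R (QuotSMulTop y M))) := by
  have hle : I ^ n • (⊤ : Submodule R M) ≤
      (I ^ (n + 1) • (⊤ : Submodule R M)).comap (LinearMap.lsmul R M y) := by
    rw [Submodule.smul_le]
    intro a ha x _
    change y • a • x ∈ I ^ (n + 1) • (⊤ : Submodule R M)
    rw [smul_smul, pow_succ']
    exact Submodule.smul_mem_smul (Ideal.mul_mem_mul hy ha) trivial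
  have hmap : (I ^ (n + 1) • (⊤ : Submodule R M)).map (y • (⊤ : Submodule R M)).mkQ =
      I ^ (n + 1) • (⊤ : Submodule R (QuotSMulTop y M)) := by
    rw [Submodule.map_smul'', Submodule.map_top, Submodule.range_mkQ]
  refine Module.length_eq_add_of_exact (Submodule.mapQ _ _ (LinearMap.lsmul R M y) hle)
    (Submodule.mapQ (I ^ (n + 1) • (⊤ : Submodule R M))
      (I ^ (n + 1) • (⊤ : Submodule R (QuotSMulTop y M))) (y • (⊤ : Submodule R M)).mkQ
      (Submodule.map_le_iff_le_comap.1 hmap.le)) ?_ ?_ ?_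
  · rw [injective_iff_map_eq_zero]
    rintro ⟨z⟩ hz
    exact (Submodule.Quotient.mk_eq_zero _).2 (h z ((Submodule.Quotient.mk_eq_zero _).1 hz))
  · rintro ⟨⟨x⟩⟩
    exact ⟨Submodule.Quotient.mk x, rfl⟩
  · rintro ⟨x⟩
    constructor
    · intro hx
      have h1 : (y • (⊤ : Submodule R M)).mkQ x ∈
          I ^ (n + 1) • (⊤ : Submodule R (QuotSMulTop y M)) :=
        (Submodule.Quotient.mk_eq_zero _).1 hx
      rw [← hmap] at h1
      obtain ⟨w, hw, hwx⟩ := h1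
      rw [← sub_eq_zero, ← map_sub, Submodule.mkQ_apply, Submodule.Quotient.mk_eq_zero] at hwx
      obtain ⟨v, -, hv⟩ := Submodule.mem_smul_pointwise_iff_exists _ _ _ |>.1 hwx
      refine ⟨Submodule.Quotient.mk (-v), ?_⟩
      refine (Submodule.Quotient.eq _).2 ?_
      change y • (-v) - x ∈ _
      rw [smul_neg, hv]
      simpa using hw
    · rintro ⟨⟨v⟩, hv⟩
      rw [← hv]
      refine (Submodule.Quotient.mk_eq_zero _).2 ?_
      change (y • (⊤ : Submodule R M)).mkQ (y • v) ∈ _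
      rw [Submodule.mkQ_apply, (Submodule.Quotient.mk_eq_zero _ (x := y • v)).2
        (Submodule.smul_mem_pointwise_smul v y ⊤ trivial)]
      exact zero_mem _
end

/-- Over an infinite residue field, a module of dimension `d` with `Ext^i(k, M) = 0` for `i < d` has a
regular sequence `ys` of length `d`, made of superficial elements, such that the limit defining
`e(M)` exists and equals `length (M/(ys)M)`. -/
theorem exists_isWeaklyRegular_tendsto_length {R : Type u} [CommRing R] [IsLocalRing R]
    [IsNoetherianRing R] [Infinite (ResidueField R)] (d : ℕ) (M : Type u) [AddCommGroup M]
    [Module R M] [Module.Finite R M] (hdim : Module.supportDim R M = d)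
    (hext : ∀ i < d, Subsingleton
      (Abelian.Ext (ModuleCat.of R (ResidueField R)) (ModuleCat.of R M) i)) :
    ∃ ys : List R, ys.length = d ∧ (∀ y ∈ ys, y ∈ maximalIdeal R) ∧
      RingTheory.Sequence.IsWeaklyRegular M ys ∧
      IsFiniteLength R (M ⧸ Ideal.ofList ys • (⊤ : Submodule R M)) ∧
      Tendsto (fun n : ℕ => (d.factorial : ℝ) *
        ((Module.length R (M ⧸ maximalIdeal R ^ n • (⊤ : Submodule R M))).toNat : ℝ) / (n : ℝ) ^ d)
        atTop
        (𝓝 ((Module.length R (M ⧸ Ideal.ofList ys • (⊤ : Submodule R M))).toNat : ℝ)) := by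
  induction d generalizing M with
  | zero =>
    obtain ⟨n, hn⟩ := exists_pow_smul_top_eq_bot_of_supportDim_eq_zero M (by simpa using hdim)
    have e : (M ⧸ Ideal.ofList ([] : List R) • (⊤ : Submodule R M)) ≃ₗ[R] M :=
      Submodule.quotEquivOfEqBot _ (by simp)
    refine ⟨[], rfl, by simp, by simp, e.symm.isFiniteLength
      (isFiniteLength_of_pow_smul_top_eq_bot M hn), tendsto_const_nhds.congr' ?_⟩
    filter_upwards [eventually_ge_atTop n] with j hj
    have hj' : maximalIdeal R ^ j • (⊤ : Submodule R M) = ⊥ :=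
      eq_bot_iff.2 (hn ▸ Submodule.smul_mono_left (Ideal.pow_le_pow_right hj))
    rw [e.length_eq, (Submodule.quotEquivOfEqBot _ hj').length_eq]
    simp
  | succ d ih =>
    have hsoc : socle R M = ⊥ := by
      have h0 := hext 0 (by omega)
      have e := ((Abelian.Ext.linearEquiv₀ (R := R) (X := ModuleCat.of R (ResidueField R))
        (Y := ModuleCat.of R M)).trans (ModuleCat.homLinearEquiv (S := R))).trans
        (homResidueFieldEquivSocle M)
      exact (Submodule.subsingleton_iff_eq_bot).1 e.symm.toEquiv.subsingleton
    obtain ⟨y, hym, hreg, n₀, hn₀⟩ := exists_isSMulRegular_superficial M hsoc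
    have hann := mem_annihilator_residueField hym
    obtain ⟨ys, hlen, hmem, hwr, hfl, hlim⟩ := ih (QuotSMulTop y M)
      (ENat.WithBot.add_one_cancel.1 (by
        rw [Module.supportDim_quotSMulTop_succ_eq_supportDim hreg hym, hdim]; push_cast; rfl))
      (fun i hi => subsingleton_ext_quotSMulTop hreg hann i (hext i (by omega))
        (hext (i + 1) (by omega)))
    have e := Submodule.quotOfListConsSMulTopEquivQuotSMulTopInner M y ys
    refine ⟨y :: ys, by simp [hlen], by simpa using ⟨hym, hmem⟩,
      (RingTheory.Sequence.isWeaklyRegular_cons_iff _ _ _).2 ⟨hreg, hwr⟩,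
      e.symm.isFiniteLength hfl, ?_⟩
    rw [e.length_eq]
    refine tendsto_factorial_mul_div_pow_succ hlim ?_
    filter_upwards [eventually_ge_atTop n₀] with n hn
    rw [length_quotient_pow_succ_smul (maximalIdeal R) hym (hn₀ n hn), ENat.toNat_add
      (Module.length_ne_top_iff.2 (isFiniteLength_quotient_pow_smul M n))
      (Module.length_ne_top_iff.2 (isFiniteLength_quotient_pow_smul _ (n + 1)))]
    push_cast
    ring

end CMModule

/-! ### Extension of the residue field -/

namespace CMModule
open IsLocalRing TensorProduct Filter Topology

/-- The local ring `R[X]` localized at `𝔪R[X]` is flat over `R`, its maximal ideal is generated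
by `𝔪`, and its residue field is infinite. -/
theorem exists_flat_extension_infinite_residueField (R : Type u) [CommRing R] [IsLocalRing R]
    [IsNoetherianRing R] :
    ∃ (B : Type u) (_ : CommRing B) (_ : IsLocalRing B) (_ : Algebra R B), IsNoetherianRing B ∧
      Module.Flat R B ∧ (maximalIdeal R).map (algebraMap R B) = maximalIdeal B ∧
      Infinite (ResidueField B) := by
  let P : Ideal (Polynomial R) := (maximalIdeal R).map Polynomial.C
  have hP : P.IsPrime := Ideal.isPrime_map_C_of_isPrime
  refine ⟨Localization.AtPrime P, inferInstance, inferInstance, inferInstance, ?_, ?_, ?_, ?_⟩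
  · exact IsLocalization.isNoetherianRing P.primeCompl _ inferInstance
  · have : Module.Flat (Polynomial R) (Localization.AtPrime P) :=
      IsLocalization.flat _ P.primeCompl
    exact Module.Flat.trans R (Polynomial R) (Localization.AtPrime P)
  · rw [← Localization.AtPrime.map_eq_maximalIdeal, Ideal.map_map]
    rfl
  · refine Infinite.of_injective (fun i : ℕ => residue (Localization.AtPrime P)
      (algebraMap (Polynomial R) _ (Polynomial.X ^ i))) fun i j hij => ?_
    by_contra hne
    rw [← sub_eq_zero, ← map_sub, ← map_sub, residue_eq_zero_iff,
      IsLocalization.AtPrime.to_map_mem_maximal_iff _ P, Ideal.mem_map_C_iff] at hij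
    have := hij i
    rw [Polynomial.coeff_sub, Polynomial.coeff_X_pow_self, Polynomial.coeff_X_pow, if_neg hne,
      sub_zero] at this
    exact (Ideal.ne_top_iff_one _).1 (maximalIdeal.isMaximal R).ne_top this

section
variable {A B : Type*} [CommRing A] [CommRing B] [Algebra A B]
  (M : Type*) [AddCommGroup M] [Module A M]

variable (B) in
/-- Base change commutes with reduction modulo an ideal. -/
noncomputable def baseChangeQuotientSMulTopEquiv (I : Ideal A) :
    ((B ⊗[A] M) ⧸ I.map (algebraMap A B) • (⊤ : Submodule B (B ⊗[A] M))) ≃ₗ[B]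
      B ⊗[A] (M ⧸ I • (⊤ : Submodule A M)) :=
  (tensorQuotEquivQuotSMul (B ⊗[A] M) (I.map (algebraMap A B))).symm ≪≫ₗ
    TensorProduct.comm B (B ⊗[A] M) _ ≪≫ₗ
    (TensorProduct.isBaseChange A M B).tensorEquiv _ ≪≫ₗ
    AlgebraTensorModule.congr (I.qoutMapEquivTensorQout B) (.refl A M) ≪≫ₗ
    AlgebraTensorModule.assoc A A B B _ M ≪≫ₗ (TensorProduct.comm A _ M).baseChange A B _ _ ≪≫ₗ
    (tensorQuotEquivQuotSMul M I).baseChange A B _ _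

variable [IsLocalRing A] [IsLocalRing B]

theorem isLocalHom_of_map_maximalIdeal_eq
    (h : (maximalIdeal A).map (algebraMap A B) = maximalIdeal B) :
    IsLocalHom (algebraMap A B) :=
  ((local_hom_TFAE (algebraMap A B)).out 0 2).2 h.le

variable [Module.Flat A B]

theorem length_baseChange_eq (h : (maximalIdeal A).map (algebraMap A B) = maximalIdeal B) :
    Module.length B (B ⊗[A] M) = Module.length A M := by
  have := isLocalHom_of_map_maximalIdeal_eq h
  rw [IsLocalRing.length_baseChange A B M, h]
  have : IsSimpleModule B (B ⧸ maximalIdeal B) :=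
    isSimpleModule_iff_quot_maximal.2 ⟨_, maximalIdeal.isMaximal B, ⟨LinearEquiv.refl _ _⟩⟩
  rw [Module.length_eq_one B (B ⧸ maximalIdeal B), mul_one]

theorem length_baseChange_quotient (h : (maximalIdeal A).map (algebraMap A B) = maximalIdeal B)
    (I : Ideal A) :
    Module.length B ((B ⊗[A] M) ⧸ I.map (algebraMap A B) • (⊤ : Submodule B (B ⊗[A] M))) =
      Module.length A (M ⧸ I • (⊤ : Submodule A M)) := by
  rw [(baseChangeQuotientSMulTopEquiv B M I).length_eq, length_baseChange_eq _ h]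

/-- The socle is the kernel of multiplication by finitely many generators of the maximal ideal, so
it commutes with flat base change. -/
theorem length_socle_baseChange [IsNoetherianRing A]
    (h : (maximalIdeal A).map (algebraMap A B) = maximalIdeal B) :
    Module.length B (socle B (B ⊗[A] M)) = Module.length A (socle A M) := by
  obtain ⟨r, s, hs⟩ := Submodule.fg_iff_exists_fin_generating_family.1
    (IsNoetherian.noetherian (maximalIdeal A))
  let φ : M →ₗ[A] (Fin r → M) := LinearMap.pi fun i => LinearMap.lsmul A M (s i)
  have hφ : ∀ x, φ x = 0 ↔ x ∈ socle A M := fun x => by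
    rw [mem_socle, funext_iff]
    constructor
    · intro hx a ha
      rw [← hs] at ha
      induction ha using Submodule.span_induction with
      | mem a ha => obtain ⟨i, rfl⟩ := ha; exact hx i
      | zero => exact zero_smul _ _
      | add a b _ _ ha hb => rw [add_smul, ha, hb, add_zero]
      | smul c a _ ha => rw [smul_assoc, ha, smul_zero]
    · exact fun hx i => hx _ (hs ▸ Submodule.subset_span ⟨i, rfl⟩)
  have hφB : ∀ z : B ⊗[A] M, φ.baseChange B z = 0 ↔ z ∈ socle B (B ⊗[A] M) := fun z => by
    have hpi : ∀ z : B ⊗[A] M, TensorProduct.piRight A B B (fun _ : Fin r => M)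
        (φ.baseChange B z) = fun i => s i • z := fun z => by
      induction z using TensorProduct.induction_on with
      | zero => ext i; simp
      | add x y hx hy => rw [map_add, map_add, hx, hy]; ext i; simp
      | tmul b x =>
        ext i
        simp [φ]
    rw [← (TensorProduct.piRight A B B (fun _ : Fin r => M)).map_eq_zero_iff, hpi, mem_socle,
      funext_iff]
    have hsB : Ideal.span (Set.range fun i => algebraMap A B (s i)) = maximalIdeal B := by
      rw [← h, ← hs, ← Ideal.span, Ideal.map_span, ← Set.range_comp]; rfl
    constructor
    · intro hz a ha
      rw [← hsB] at ha
      induction ha using Submodule.span_induction with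
      | mem a ha => obtain ⟨i, rfl⟩ := ha; simpa using hz i
      | zero => exact zero_smul _ _
      | add a b _ _ ha hb => rw [add_smul, ha, hb, add_zero]
      | smul c a _ ha => rw [smul_assoc, ha, smul_zero]
    · intro hz i
      rw [← algebraMap_smul B (s i) z]
      exact hz _ (hsB ▸ Submodule.subset_span ⟨i, rfl⟩)
  let ι := (socle A M).subtype.baseChange B
  have hinj : Function.Injective ι :=
    Module.Flat.lTensor_preserves_injective_linearMap _ (Submodule.subtype_injective _)
  have hex : Function.Exact ι (φ.baseChange B) :=
    Module.Flat.lTensor_exact B (f := (socle A M).subtype) (g := φ) fun x => by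
      rw [hφ]; simp
  have hrange : LinearMap.range ι = socle B (B ⊗[A] M) := by
    ext z
    rw [← hφB, hex z]; rfl
  rw [← hrange, ← (LinearEquiv.ofInjective ι hinj).length_eq, length_baseChange_eq _ h]

theorem mu_baseChange [Module.Finite A M]
    (h : (maximalIdeal A).map (algebraMap A B) = maximalIdeal B) :
    mu B (B ⊗[A] M) = mu A M := by
  have h1 : (mu B (B ⊗[A] M) : ℕ∞) = mu A M := by
    rw [mu_eq_length_quotient, mu_eq_length_quotient, ← h, length_baseChange_quotient M h]
  exact_mod_cast h1

end

/-- A Cohen-Macaulay module has a regular sequence whose length is its dimension. -/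
theorem exists_isWeaklyRegular_of_isCM {R : Type*} [CommRing R] [IsLocalRing R]
    [IsNoetherianRing R] {M : Type*} [AddCommGroup M] [Module R M] [Nontrivial M]
    (hM : IsCM R M) :
    ∃ (d : ℕ) (rs : List R), Module.supportDim R M = d ∧ depth R M = d ∧ rs.length = d ∧
      (∀ r ∈ rs, r ∈ maximalIdeal R) ∧ RingTheory.Sequence.IsWeaklyRegular M rs := by
  have hM := hM.resolve_left (not_subsingleton M)
  have hlt : depth R M < ⊤ := by
    have h1 : ((depth R M : ℕ∞) : WithBot ℕ∞) < ⊤ := by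
      rw [hM]
      exact (Module.supportDim_le_ringKrullDim R M).trans_lt ringKrullDim_lt_top
    exact lt_top_iff_ne_top.2 fun h => by rw [h] at h1; exact lt_irrefl _ h1
  obtain ⟨d, hd⟩ := ENat.ne_top_iff_exists.1 hlt.ne
  suffices h : ∃ rs : List R, rs.length = d ∧ (∀ r ∈ rs, r ∈ maximalIdeal R) ∧
      RingTheory.Sequence.IsWeaklyRegular M rs by
    obtain ⟨rs, h1, h2, h3⟩ := h
    exact ⟨d, rs, by rw [← hM, ← hd]; rfl, hd.symm, h1, h2, h3⟩
  by_contra! hno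
  rcases Nat.eq_zero_or_pos d with rfl | hpos
  · exact hno [] rfl (by simp) (by simp)
  -- a supremum of natural numbers that is finite and positive is attained
  have hle : depth R M ≤ ((d - 1 : ℕ) : ℕ∞) := by
    refine iSup_le fun rs => iSup_le fun h1 => iSup_le fun h2 => ?_
    have h3 : (rs.length : ℕ∞) ≤ depth R M :=
      le_iSup_of_le rs (le_iSup_of_le h1 (le_iSup_of_le h2 le_rfl))
    rw [← hd, Nat.cast_le] at h3
    have h4 : rs.length ≠ d := fun h => hno rs h h1 h2
    exact_mod_cast (by omega : rs.length ≤ d - 1)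
  rw [← hd, Nat.cast_le] at hle
  omega

theorem mult_eq_of_tendsto {R : Type*} [CommRing R] [IsLocalRing R] {M : Type*} [AddCommGroup M]
    [Module R M] {d : ℕ} (hd : Module.supportDim R M = d) {e : ℝ}
    (h : Tendsto (fun n : ℕ => (d.factorial : ℝ) *
        ((Module.length R (M ⧸ maximalIdeal R ^ n • (⊤ : Submodule R M))).toNat : ℝ) / (n : ℝ) ^ d)
        atTop (𝓝 e)) : mult R M = e := by
  have hdim : dim R M = d := by
    rw [dim, hd]; rfl
  rw [mult, hsMult, hdim]
  exact h.limUnder_eq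

/-- Multiplicity, number of generators and type of a Cohen-Macaulay module are the length, the
number of generators and the length of the socle of a single module of finite length, over a flat
local extension of the base ring. -/
theorem exists_finiteLength_model (R : Type u) [CommRing R] [IsLocalRing R] [IsNoetherianRing R]
    (M : Type u) [AddCommGroup M] [Module R M] [Module.Finite R M] [Nontrivial M]
    (hM : IsCM R M) :
    ∃ (B : Type u) (_ : CommRing B) (_ : IsLocalRing B) (L : Type u) (_ : AddCommGroup L)
      (_ : Module B L), Module.Finite B L ∧ IsFiniteLength B L ∧
      mult R M = ((Module.length B L).toNat : ℝ) ∧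
      mu R M = mu B L ∧ (type R M : ℕ∞) = Module.length B (socle B L) := by
  obtain ⟨d, rs, hdim, hdepth, hlen, hmem, hwr⟩ := exists_isWeaklyRegular_of_isCM hM
  obtain ⟨B, _, _, _, _, _, hB, _⟩ := exists_flat_extension_infinite_residueField R
  have := isLocalHom_of_map_maximalIdeal_eq hB
  have : Module.FaithfullyFlat R B := Module.FaithfullyFlat.of_flat_of_isLocalHom
  let N : Type u := B ⊗[R] M
  have hreg : RingTheory.Sequence.IsRegular M rs :=
    (isWeaklyRegular_iff_isRegular R M rs hmem).1 hwr
  let rs' : List B := rs.map (algebraMap R B)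
  have hmem' : ∀ r ∈ rs', r ∈ maximalIdeal B := by
    intro r hr
    obtain ⟨a, ha, rfl⟩ := List.mem_map.1 hr
    exact hB ▸ Ideal.mem_map_of_mem _ (hmem a ha)
  have hreg' : RingTheory.Sequence.IsRegular N rs' :=
    hreg.of_faithfullyFlat_of_isBaseChange (TensorProduct.isBaseChange R M B)
  have hlen' : rs'.length = d := by simp [rs', hlen]
  -- reduction modulo `rs` commutes with the base change
  let e : (N ⧸ Ideal.ofList rs' • (⊤ : Submodule B N)) ≃ₗ[B]
      B ⊗[R] (M ⧸ Ideal.ofList rs • (⊤ : Submodule R M)) :=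
    (Submodule.quotEquivOfEq _ _ (by rw [Ideal.map_ofList])).trans
      (baseChangeQuotientSMulTopEquiv B M (Ideal.ofList rs))
  have : Nontrivial N := inferInstance
  have hdimN : Module.supportDim B N = d := by
    have h1 := Module.supportDim_add_length_eq_supportDim_of_isRegular rs hreg
    have h2 : Module.supportDim R (M ⧸ Ideal.ofList rs • (⊤ : Submodule R M)) = 0 := by
      rw [hlen, hdim] at h1
      exact ENat.WithBot.add_natCast_cancel.1 (h1.trans (zero_add _).symm)
    -- `M/(rs)M` has dimension zero, so a power of the maximal ideal kills it and its base change
    obtain ⟨n, hn⟩ := exists_pow_smul_top_eq_bot_of_supportDim_eq_zero _ h2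
    have hnt : Nontrivial (N ⧸ Ideal.ofList rs' • (⊤ : Submodule B N)) :=
      Submodule.Quotient.nontrivial_iff.2 hreg'.2.symm
    have h3 : maximalIdeal B ^ n •
        (⊤ : Submodule B (N ⧸ Ideal.ofList rs' • (⊤ : Submodule B N))) = ⊥ := by
      rw [← Submodule.le_annihilator_iff, Submodule.annihilator_top] at hn ⊢
      rw [← hB, ← Ideal.map_pow, e.annihilator_eq, Ideal.map_le_iff_le_comap]
      refine hn.trans fun a ha => Module.mem_annihilator.2 fun z => ?_
      rw [algebraMap_smul]
      induction z using TensorProduct.induction_on with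
      | zero => exact smul_zero a
      | add x y hx hy => rw [smul_add, hx, hy, add_zero]
      | tmul b x => rw [← TensorProduct.tmul_smul, Module.mem_annihilator.1 ha, tmul_zero]
    rw [← Module.supportDim_add_length_eq_supportDim_of_isRegular rs' hreg', hlen',
      supportDim_eq_zero_of_pow_smul_top_eq_bot h3, zero_add]
  obtain ⟨ys, hyl, hym, hyr, hfl, hlim⟩ := exists_isWeaklyRegular_tendsto_length d N hdimN
    fun i hi => subsingleton_ext_of_isWeaklyRegular rs' N
      (fun r hr => mem_annihilator_residueField (hmem' r hr)) hreg'.1 i (by omega)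
  refine ⟨B, inferInstance, inferInstance, N ⧸ Ideal.ofList ys • (⊤ : Submodule B N),
    inferInstance, inferInstance, inferInstance, hfl, ?_, ?_, ?_⟩
  · refine mult_eq_of_tendsto hdim (hlim.congr fun n => ?_)
    rw [← hB, ← Ideal.map_pow, length_baseChange_quotient M hB]
  · rw [mu_quotient_smul_top N (show Ideal.ofList ys ≤ maximalIdeal B from Ideal.span_le.2 hym), mu_baseChange M hB]
  · have h1 : type R M = bass R M rs.length := by
      rw [type, hdepth, hlen]; rfl
    have h2 : Module.length B (socle B (N ⧸ Ideal.ofList rs' • (⊤ : Submodule B N))) =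
        Module.length B (socle B (B ⊗[R] (M ⧸ Ideal.ofList rs • (⊤ : Submodule R M)))) :=
      ((homResidueFieldEquivSocle _).symm.trans
        ((LinearEquiv.congrRight e).trans (homResidueFieldEquivSocle _))).length_eq
    rw [h1, bass_eq_length_socle hmem M hwr, ← bass_eq_length_socle hym N hyr, hyl, ← hlen',
      bass_eq_length_socle hmem' N hreg'.1, h2, length_socle_baseChange _ hB]

end CMModule

/-! ### Comparison of multiplicity, number of generators and type -/

theorem mainTheorem10 (R : Type u) [CommRing R] [IsLocalRing R] [IsNoetherianRing R]
    (M : Type u) [AddCommGroup M] [Module R M] [Module.Finite R M]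
    (hM : CMModule.IsCM R M) :
    ((max (CMModule.mu R M) (CMModule.type R M) : ℕ) : ℝ) ≤ CMModule.mult R M ∧
    (CMModule.mult R M = (CMModule.mu R M : ℝ) ↔
      CMModule.mult R M = (CMModule.type R M : ℝ)) ∧
    (Nontrivial M →
      (CMModule.IsUlrich R M ↔ CMModule.mult R M = (CMModule.type R M : ℝ))) := by
  suffices h : ((max (CMModule.mu R M) (CMModule.type R M) : ℕ) : ℝ) ≤ CMModule.mult R M ∧
      (CMModule.mult R M = (CMModule.mu R M : ℝ) ↔
        CMModule.mult R M = (CMModule.type R M : ℝ)) from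
    ⟨h.1, h.2, fun hn => ⟨fun hU => h.2.1 hU.mult_eq, fun he => ⟨hn, hM, h.2.2 he⟩⟩⟩
  rcases subsingleton_or_nontrivial M with hs | hn
  · have hmu : ∀ (N : Type u) [AddCommGroup N] [Module R N] [Subsingleton N],
        CMModule.mu R N = 0 := fun N _ _ _ => by
      rw [CMModule.mu, Submodule.eq_bot_of_subsingleton (p := ⊤), Submodule.spanFinrank_bot]
    have hty : CMModule.type R M = 0 := by
      have hz : Limits.IsZero (ModuleCat.of R M) := ModuleCat.isZero_of_subsingleton _
      have : Subsingleton (Abelian.Ext (ModuleCat.of R (IsLocalRing.ResidueField R))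
          (ModuleCat.of R M) (CMModule.depth R M).toNat) :=
        have := hz.hasInjectiveDimensionLT_zero
        HasInjectiveDimensionLT.subsingleton (ModuleCat.of R M) 0 _ (Nat.zero_le _) _
      exact hmu _
    have hmult : CMModule.mult R M = 0 := by
      rw [CMModule.mult, CMModule.hsMult]
      refine Filter.Tendsto.limUnder_eq ?_
      simp
    rw [hmu M, hty, hmult]
    simp
  · obtain ⟨B, _, _, L, _, _, _, hfl, hmult, hmu, htype⟩ :=
      CMModule.exists_finiteLength_model R M hM
    obtain ⟨ℓ, hℓ⟩ := ENat.ne_top_iff_exists.1 (Module.length_ne_top_iff.2 hfl)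
    have h1 := CMModule.mu_le_length (R := B) L
    have h2 := CMModule.length_socle_le (R := B) L
    have h3 := CMModule.length_eq_mu_iff_length_eq_length_socle hfl
    rw [← htype, ← hℓ] at h2 h3
    rw [← hmu, ← hℓ] at h1
    rw [← hmu] at h3
    rw [hmult, ← hℓ, ENat.toNat_natCast]
    norm_cast at h1 h2 h3 ⊢
    exact ⟨max_le h1 h2, h3⟩
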